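/- Let $\mathbf{T}=\mathbf{R}/\mathbf{Z}$ with its Haar measure, let $\alpha\in\mathbf{T}$ and let $A:\mathbf{T}\to SL(2,\mathbf{R})$ be continuous. For $n\ge 1$ and $\theta\in\mathbf{T}$ put $$A_n(\theta)=A(\theta+(n-1)\alpha)\cdots A(\theta),\qquad A_{-n}(\theta)=A(\theta-n\alpha)^{-1}\cdots A(\theta-\alpha)^{-1},\qquad A_0(\theta)=I .$$ Suppose that the cocycle $(\alpha,A)$ has bounded fibered products, that is, $$\sup_{k\in\mathbf{Z}}\ \sup_{\theta\in\mathbf{T}}\|A_k(\theta)\|<\infty .$$ Then there is a measurable map $B:\mathbf{T}\to SL(2,\mathbf{R})$ with $\operatorname{ess\,sup}_{\theta\in\mathbf{T}}\|B(\theta)\|<\infty$ such that, for almost every $\theta\in\mathbf{T}$, the matrix $$B(\theta+\alpha)^{-1}A(\theta)B(\theta)$$ is a rotation matrix, i.e. an element of $SO(2,\mathbf{R})$. -/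

import Mathlib

open MeasureTheory
open scoped MatrixGroups

/-- Forward fibered products over the rotation by `α`:
`A_n(θ) = A(θ + (n-1)α) ⋯ A(θ)` for `n ≥ 1`, and `A_0 = 1`. -/
def fiberedProductPos (α : UnitAddCircle) (A : UnitAddCircle → SL(2, ℝ)) :
    ℕ → UnitAddCircle → SL(2, ℝ)
  | 0, _ => 1
  | n + 1, θ => A (θ + n • α) * fiberedProductPos α A n θ

/-- Backward fibered products over the rotation by `α`:
`A_{-n}(θ) = A(θ - nα)⁻¹ ⋯ A(θ - α)⁻¹` for `n ≥ 1`, and `A_0 = 1`. -/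
def fiberedProductNeg (α : UnitAddCircle) (A : UnitAddCircle → SL(2, ℝ)) :
    ℕ → UnitAddCircle → SL(2, ℝ)
  | 0, _ => 1
  | n + 1, θ => (A (θ - (n + 1) • α))⁻¹ * fiberedProductNeg α A n θ

/-- The fibered products `A_k`, `k ∈ ℤ`, of the cocycle `(α, A)`; they satisfy
`(α, A)^k (θ, y) = (θ + kα, A_k(θ) y)`. -/
def fiberedProduct (α : UnitAddCircle) (A : UnitAddCircle → SL(2, ℝ)) :
    ℤ → UnitAddCircle → SL(2, ℝ)
  | Int.ofNat n => fiberedProductPos α A n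
  | Int.negSucc n => fiberedProductNeg α A (n + 1)

open scoped Matrix.Norms.Elementwise in
/-- `sup_{k ∈ ℤ} sup_{θ ∈ 𝕋} ‖A_k(θ)‖ < ∞`, with the maximum of the absolute values of the
entries as norm (all norms on real `2 × 2` matrices are equivalent). -/
def HasBoundedFiberedProducts (α : UnitAddCircle) (A : UnitAddCircle → SL(2, ℝ)) : Prop :=
  ∃ C : ℝ, ∀ (k : ℤ) (θ : UnitAddCircle),
    ‖(fiberedProduct α A k θ : Matrix (Fin 2) (Fin 2) ℝ)‖ ≤ C

open scoped Matrix.Norms.Elementwise in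
/-- `B : 𝕋 → SL(2, ℝ)` is essentially bounded for the Haar measure of `𝕋`, as a matrix-valued
map. -/
def IsLinftyBounded (B : UnitAddCircle → SL(2, ℝ)) : Prop :=
  MemLp (fun θ => (B θ : Matrix (Fin 2) (Fin 2) ℝ)) ⊤ (volume : Measure UnitAddCircle)

/-- Measurability of `B : 𝕋 → SL(2, ℝ)`, for the Borel structure that `SL(2, ℝ)` inherits from
the space of matrices. -/
def IsMeasurableSL (B : UnitAddCircle → SL(2, ℝ)) : Prop :=
  ∀ i j : Fin 2, Measurable (fun θ => (B θ : Matrix (Fin 2) (Fin 2) ℝ) i j)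

/-- Rotation matrices, that is, the elements of `SO(2, ℝ)`. -/
def IsRotationMatrix (M : SL(2, ℝ)) : Prop :=
  ∃ φ : ℝ, (M : Matrix (Fin 2) (Fin 2) ℝ) =
    !![Real.cos φ, -Real.sin φ; Real.sin φ, Real.cos φ]

open Matrix

/-! Let `E θ` (`orbitBall`) be the set of vectors whose full orbit stays in the unit ball. Since all
integer times are imposed, `A θ` carries `E θ` onto `E (θ + α)`; bounded products make every `E θ`
contain one fixed ball. As `A θ` preserves area, the second moments `M θ = ∫ v vᵀ` over `E θ`
satisfy `M (θ + α) = A θ * M θ * (A θ)ᵀ`, and `det (M θ)` is invariant along orbits. The two balls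
bound `M` above and `det M` away from zero, so `M θ / √det = B θ * (B θ)ᵀ` has a bounded Cholesky
factor, measurable because its entries are explicit in those of `M`. Equivariance makes `B (θ + α)⁻¹
* A θ * B θ` orthogonal of determinant one, for every `θ`. -/

theorem fiberedProductPos_add_mul (α : UnitAddCircle) (A : UnitAddCircle → SL(2, ℝ)) (n : ℕ)
    (θ : UnitAddCircle) :
    fiberedProductPos α A n (θ + α) * A θ = fiberedProductPos α A (n + 1) θ := by
  induction n with
  | zero => simp [fiberedProductPos]
  | succ n ih =>
    change A (θ + α + n • α) * _ * A θ = A (θ + (n + 1) • α) * _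
    rw [mul_assoc, ih, succ_nsmul', add_assoc]

theorem fiberedProductNeg_add_mul (α : UnitAddCircle) (A : UnitAddCircle → SL(2, ℝ)) (n : ℕ)
    (θ : UnitAddCircle) :
    fiberedProductNeg α A (n + 1) (θ + α) * A θ = fiberedProductNeg α A n θ := by
  induction n with
  | zero => simp [fiberedProductNeg]
  | succ n ih =>
    rw [fiberedProductNeg, mul_assoc, ih, fiberedProductNeg, succ_nsmul _ (n + 1),
      add_sub_add_right_eq_sub]

/-- The cocycle identity `A_k(θ + α) A(θ) = A_{k+1}(θ)`. -/
theorem fiberedProduct_add_mul (α : UnitAddCircle) (A : UnitAddCircle → SL(2, ℝ)) (k : ℤ)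
    (θ : UnitAddCircle) :
    fiberedProduct α A k (θ + α) * A θ = fiberedProduct α A (k + 1) θ := by
  match k with
  | Int.ofNat n => exact fiberedProductPos_add_mul α A n θ
  | Int.negSucc 0 => exact fiberedProductNeg_add_mul α A 0 θ
  | Int.negSucc (n + 1) => exact fiberedProductNeg_add_mul α A (n + 1) θ

theorem continuous_fiberedProductPos (α : UnitAddCircle) {A : UnitAddCircle → SL(2, ℝ)}
    (hA : Continuous A) (n : ℕ) : Continuous (fiberedProductPos α A n) := by
  induction n with
  | zero => exact continuous_const
  | succ n ih => exact (hA.comp (continuous_add_const _)).mul ih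

theorem continuous_fiberedProductNeg (α : UnitAddCircle) {A : UnitAddCircle → SL(2, ℝ)}
    (hA : Continuous A) (n : ℕ) : Continuous (fiberedProductNeg α A n) := by
  induction n with
  | zero => exact continuous_const
  | succ n ih => exact (hA.comp (continuous_sub_right _)).inv.mul ih

theorem continuous_fiberedProduct (α : UnitAddCircle) {A : UnitAddCircle → SL(2, ℝ)}
    (hA : Continuous A) (k : ℤ) : Continuous (fiberedProduct α A k) := by
  match k with
  | Int.ofNat n => exact continuous_fiberedProductPos α hA n
  | Int.negSucc n => exact continuous_fiberedProductNeg α hA (n + 1)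

/-! ### The invariant family of planar sets -/

/-- The vectors whose whole orbit under the cocycle stays in the unit ball. -/
def orbitBall (α : UnitAddCircle) (A : UnitAddCircle → SL(2, ℝ)) (θ : UnitAddCircle) :
    Set (Fin 2 → ℝ) :=
  {v | ∀ k : ℤ, ‖(fiberedProduct α A k θ : Matrix (Fin 2) (Fin 2) ℝ) *ᵥ v‖ ≤ 1}

/-- The cocycle identity shifts the time `k` by one, a bijection of `ℤ`; forward times alone would
give only an inclusion. -/
theorem preimage_orbitBall (α : UnitAddCircle) (A : UnitAddCircle → SL(2, ℝ))
    (θ : UnitAddCircle) :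
    (fun v => (A θ : Matrix (Fin 2) (Fin 2) ℝ) *ᵥ v) ⁻¹' orbitBall α A (θ + α) =
      orbitBall α A θ := by
  ext v
  simp only [orbitBall, Set.mem_preimage, Set.mem_ofPred_eq, mulVec_mulVec,
    ← Matrix.SpecialLinearGroup.coe_mul, fiberedProduct_add_mul]
  exact (Equiv.addRight (1 : ℤ)).forall_congr fun k => Iff.rfl

/-- Joint closedness is what later makes the moments, as parameter integrals, measurable in `θ`. -/
theorem isClosed_setOf_mem_orbitBall (α : UnitAddCircle) {A : UnitAddCircle → SL(2, ℝ)}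
    (hA : Continuous A) :
    IsClosed {p : UnitAddCircle × (Fin 2 → ℝ) | p.2 ∈ orbitBall α A p.1} := by
  have hset : {p : UnitAddCircle × (Fin 2 → ℝ) | p.2 ∈ orbitBall α A p.1} =
      ⋂ k : ℤ, {p | ‖(fiberedProduct α A k p.1 : Matrix (Fin 2) (Fin 2) ℝ) *ᵥ p.2‖ ≤ 1} := by
    ext p
    simp [orbitBall]
  rw [hset]
  refine isClosed_iInter fun k => isClosed_le ?_ continuous_const
  exact ((Continuous.comp (g := fun g : SL(2, ℝ) => (g : Matrix (Fin 2) (Fin 2) ℝ))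
    continuous_subtype_val ((continuous_fiberedProduct α hA k).comp
    continuous_fst)).matrix_mulVec continuous_snd).norm

theorem measurableSet_orbitBall (α : UnitAddCircle) {A : UnitAddCircle → SL(2, ℝ)}
    (hA : Continuous A) (θ : UnitAddCircle) : MeasurableSet (orbitBall α A θ) :=
  ((isClosed_setOf_mem_orbitBall α hA).preimage (Continuous.prodMk_right θ)).measurableSet

theorem orbitBall_subset_closedBall (α : UnitAddCircle) (A : UnitAddCircle → SL(2, ℝ))
    (θ : UnitAddCircle) : orbitBall α A θ ⊆ Metric.closedBall 0 1 := by
  intro v hv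
  have h := hv 0
  have h0 : fiberedProduct α A 0 θ = 1 := rfl
  simpa [h0] using h

theorem exists_closedBall_subset_orbitBall {α : UnitAddCircle} {A : UnitAddCircle → SL(2, ℝ)}
    (h : HasBoundedFiberedProducts α A) :
    ∃ r > 0, ∀ θ, Metric.closedBall 0 r ⊆ orbitBall α A θ := by
  obtain ⟨C, hC⟩ := h
  have hC' : ∀ k θ i j, |(fiberedProduct α A k θ : Matrix (Fin 2) (Fin 2) ℝ) i j| ≤ max C 1 :=
    fun k θ i j => (Matrix.norm_entry_le_entrywise_sup_norm _).trans
      ((hC k θ).trans (le_max_left _ _))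
  have hpos : 0 < max C 1 := lt_max_of_lt_right one_pos
  -- The factor 2 absorbs the two summands of each coordinate; `max C 1` keeps the denominator
  -- positive.
  refine ⟨1 / (2 * max C 1), by positivity, fun θ v hv k => ?_⟩
  rw [mem_closedBall_zero_iff] at hv
  refine (pi_norm_le_iff_of_nonneg zero_le_one).2 fun i => ?_
  rw [mulVec, dotProduct]
  refine (norm_sum_le _ _).trans ?_
  have key : ∀ j, ‖(fiberedProduct α A k θ : Matrix (Fin 2) (Fin 2) ℝ) i j * v j‖ ≤ 1 / 2 := by
    intro j
    rw [norm_mul]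
    calc _ ≤ max C 1 * (1 / (2 * max C 1)) :=
          mul_le_mul (hC' k θ i j) ((norm_le_pi_norm v j).trans hv) (norm_nonneg _) hpos.le
      _ = 1 / 2 := by field_simp
  rw [Fin.sum_univ_two]
  linarith [key 0, key 1]

/-! ### Second moments -/

/-- The matrix of second moments of a planar set. -/
noncomputable def momentMatrix (E : Set (Fin 2 → ℝ)) : Matrix (Fin 2) (Fin 2) ℝ :=
  Matrix.of fun i j => ∫ v in E, v i * v j

theorem integrableOn_mul_coord {E : Set (Fin 2 → ℝ)} (hE : E ⊆ Metric.closedBall 0 1)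
    (i j : Fin 2) : IntegrableOn (fun v : Fin 2 → ℝ => v i * v j) E :=
  (((continuous_apply i).mul (continuous_apply j)).continuousOn.integrableOn_compact
    (isCompact_closedBall _ _)).mono_set hE

theorem setIntegral_preimage_mulVec (g : Matrix (Fin 2) (Fin 2) ℝ) (hg : |g.det| = 1)
    {E : Set (Fin 2 → ℝ)} (hE : MeasurableSet E) {f : (Fin 2 → ℝ) → ℝ} (hf : Continuous f) :
    ∫ v in (fun v => g *ᵥ v) ⁻¹' E, f (g *ᵥ v) = ∫ v in E, f v := by
  have hmap : Measure.map (fun v => g *ᵥ v) volume = (volume : Measure (Fin 2 → ℝ)) := by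
    have h := Real.map_matrix_volume_pi_eq_smul_volume_pi (M := g) (by
      intro h0; simp [h0] at hg)
    rw [abs_inv, hg, inv_one, ENNReal.ofReal_one, one_smul] at h
    exact h
  rw [← setIntegral_map hE (hf.aestronglyMeasurable)
    (by fun_prop : Continuous fun v => g *ᵥ v).aemeasurable, hmap]

/-- Change of variables `v ↦ g v`, which preserves area and turns `v vᵀ` into `g v vᵀ gᵀ`. -/
theorem momentMatrix_eq_mul_mul_transpose (g : Matrix (Fin 2) (Fin 2) ℝ) (hg : |g.det| = 1)
    {E : Set (Fin 2 → ℝ)} (hE : MeasurableSet E)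
    (hE' : (fun v => g *ᵥ v) ⁻¹' E ⊆ Metric.closedBall 0 1) :
    momentMatrix E = g * momentMatrix ((fun v => g *ᵥ v) ⁻¹' E) * gᵀ := by
  ext i j
  have hint := integrableOn_mul_coord hE'
  have h := setIntegral_preimage_mulVec g hg hE (f := fun v => v i * v j) (by fun_prop)
  simp only [momentMatrix, of_apply, mul_apply, transpose_apply, Fin.sum_univ_two]
  rw [← h]
  have hexp : ∀ v : Fin 2 → ℝ, (g *ᵥ v) i * (g *ᵥ v) j =
      ((g i 0 * g j 0) * (v 0 * v 0) + (g i 1 * g j 0) * (v 1 * v 0)) +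
      ((g i 0 * g j 1) * (v 0 * v 1) + (g i 1 * g j 1) * (v 1 * v 1)) := by
    intro v
    simp only [mulVec, dotProduct, Fin.sum_univ_two]
    ring
  simp only [hexp]
  rw [integral_add (by exact ((hint 0 0).const_mul _).add ((hint 1 0).const_mul _))
    (by exact ((hint 0 1).const_mul _).add ((hint 1 1).const_mul _)),
    integral_add ((hint 0 0).const_mul _) ((hint 1 0).const_mul _),
    integral_add ((hint 0 1).const_mul _) ((hint 1 1).const_mul _)]
  simp only [integral_const_mul]
  ring

theorem momentMatrix_symm (E : Set (Fin 2 → ℝ)) : momentMatrix E 1 0 = momentMatrix E 0 1 := by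
  simp only [momentMatrix, of_apply, mul_comm]

theorem momentMatrix_quadratic {E : Set (Fin 2 → ℝ)} (hE : E ⊆ Metric.closedBall 0 1)
    (a b : ℝ) :
    ∫ v in E, (a * v 0 + b * v 1) ^ 2 = a ^ 2 * momentMatrix E 0 0 +
      2 * a * b * momentMatrix E 0 1 + b ^ 2 * momentMatrix E 1 1 := by
  have hint := integrableOn_mul_coord hE
  have hexp : ∀ v : Fin 2 → ℝ, (a * v 0 + b * v 1) ^ 2 =
      (a ^ 2 * (v 0 * v 0) + 2 * a * b * (v 0 * v 1)) + b ^ 2 * (v 1 * v 1) := by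
    intro v; ring
  simp only [hexp, momentMatrix, of_apply]
  rw [integral_add (by exact ((hint 0 0).const_mul _).add ((hint 0 1).const_mul _))
    ((hint 1 1).const_mul _), integral_add ((hint 0 0).const_mul _) ((hint 0 1).const_mul _)]
  simp only [integral_const_mul]

theorem momentMatrix_diag_mono {E F : Set (Fin 2 → ℝ)} (hEF : E ⊆ F)
    (hF : F ⊆ Metric.closedBall 0 1) (i : Fin 2) : momentMatrix E i i ≤ momentMatrix F i i :=
  setIntegral_mono_set (integrableOn_mul_coord hF i i)
    (Filter.Eventually.of_forall fun v => mul_self_nonneg (v i)) hEF.eventuallyLE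

/-- The sup-norm ball is invariant under swapping coordinates; the next lemma uses a sign change
instead. -/
theorem momentMatrix_closedBall_diag_eq (r : ℝ) :
    momentMatrix (Metric.closedBall 0 r) 1 1 = momentMatrix (Metric.closedBall 0 r) 0 0 := by
  have h := setIntegral_preimage_mulVec !![0, 1; 1, 0] (by simp [det_fin_two_of])
    (Metric.isClosed_closedBall (x := (0 : Fin 2 → ℝ)) (ε := r)).measurableSet
    (f := fun v => v 0 * v 0) (by fun_prop)
  have hs : (fun v => !![(0 : ℝ), 1; 1, 0] *ᵥ v) ⁻¹' Metric.closedBall 0 r =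
      Metric.closedBall 0 r := by
    ext v
    simp [Pi.norm_def, Fin.univ_succ, dotProduct, sup_comm]
  rw [hs] at h
  simpa [momentMatrix, mulVec, dotProduct] using h

theorem momentMatrix_closedBall_off_diag (r : ℝ) :
    momentMatrix (Metric.closedBall 0 r) 0 1 = 0 := by
  have h := setIntegral_preimage_mulVec !![-1, 0; 0, 1] (by simp [det_fin_two_of])
    (Metric.isClosed_closedBall (x := (0 : Fin 2 → ℝ)) (ε := r)).measurableSet
    (f := fun v => v 0 * v 1) (by fun_prop)
  have hs : (fun v => !![(-1 : ℝ), 0; 0, 1] *ᵥ v) ⁻¹' Metric.closedBall 0 r =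
      Metric.closedBall 0 r := by
    ext v
    simp [Pi.norm_def, Fin.univ_succ, dotProduct]
  rw [hs] at h
  simp [mulVec, dotProduct, integral_neg] at h
  simp only [momentMatrix, of_apply]
  linarith

theorem momentMatrix_closedBall_pos {r : ℝ} (hr : 0 < r) :
    0 < momentMatrix (Metric.closedBall 0 r) 0 0 := by
  simp only [momentMatrix, of_apply]
  have hc : Continuous fun v : Fin 2 → ℝ => v 0 * v 0 := by fun_prop
  rw [setIntegral_pos_iff_support_of_nonneg_ae (f := fun v : Fin 2 → ℝ => v 0 * v 0)
    (Filter.Eventually.of_forall fun v => mul_self_nonneg (v 0))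
    (hc.continuousOn.integrableOn_compact (isCompact_closedBall _ _))]
  refine lt_of_lt_of_le ?_ (measure_mono (Set.inter_subset_inter_right _
    Metric.ball_subset_closedBall))
  refine (hc.isOpen_support.inter Metric.isOpen_ball).measure_pos volume
    ⟨fun _ => r / 2, ?_, ?_⟩
  · simp [hr.ne']
  · rw [mem_ball_zero_iff, pi_norm_const, Real.norm_eq_abs, abs_of_pos (by linarith)]
    linarith

/-- The form of second moments of a set containing a ball dominates that of the ball. -/
theorem sq_le_det_momentMatrix {E : Set (Fin 2 → ℝ)} {r : ℝ} (hr : 0 < r)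
    (hrE : Metric.closedBall 0 r ⊆ E) (hE : E ⊆ Metric.closedBall 0 1) :
    momentMatrix (Metric.closedBall 0 r) 0 0 ^ 2 ≤
      momentMatrix E 0 0 * momentMatrix E 1 1 - momentMatrix E 0 1 ^ 2 := by
  set c := momentMatrix (Metric.closedBall 0 r) 0 0 with hc
  have hcpos : 0 < c := momentMatrix_closedBall_pos hr
  have key : ∀ a b : ℝ, c * (a ^ 2 + b ^ 2) ≤ a ^ 2 * momentMatrix E 0 0 +
      2 * a * b * momentMatrix E 0 1 + b ^ 2 * momentMatrix E 1 1 := by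
    intro a b
    have hcont : Continuous fun v : Fin 2 → ℝ => (a * v 0 + b * v 1) ^ 2 := by fun_prop
    have h := setIntegral_mono_set (μ := volume)
      ((hcont.continuousOn.integrableOn_compact (isCompact_closedBall _ _)).mono_set hE)
      (Filter.Eventually.of_forall fun v => sq_nonneg (a * v 0 + b * v 1)) hrE.eventuallyLE
    rw [momentMatrix_quadratic hE, momentMatrix_quadratic (hrE.trans hE),
      momentMatrix_closedBall_diag_eq, momentMatrix_closedBall_off_diag, ← hc] at h
    linarith
  have h0 := key 1 0
  have h1 := key 0 1
  -- The form minus `c` times the identity is nonnegative, so its discriminant is nonpositive; with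
  -- both diagonal entries at least `c` this yields the bound.
  have hdisc := discrim_le_zero (a := momentMatrix E 0 0 - c) (b := 2 * momentMatrix E 0 1)
    (c := momentMatrix E 1 1 - c) (fun x => by linarith [key x 1])
  rw [discrim] at hdisc
  nlinarith

theorem measurable_momentMatrix_orbitBall (α : UnitAddCircle) {A : UnitAddCircle → SL(2, ℝ)}
    (hA : Continuous A) (i j : Fin 2) :
    Measurable fun θ => momentMatrix (orbitBall α A θ) i j := by
  have hm : Measurable ({p : UnitAddCircle × (Fin 2 → ℝ) | p.2 ∈ orbitBall α A p.1}.indicator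
      fun p => p.2 i * p.2 j) :=
    Measurable.indicator (by fun_prop) (isClosed_setOf_mem_orbitBall α hA).measurableSet
  have h := (hm.stronglyMeasurable.integral_prod_right' (ν := volume)).measurable
  convert h using 2 with θ
  simp only [momentMatrix, of_apply]
  rw [← integral_indicator (measurableSet_orbitBall α hA θ)]
  rfl

/-! ### Cholesky factor and rotations -/

/-- The lower triangular factor of the symmetric matrix of determinant `d` with first row `(p, q)`,
after rescaling that matrix to determinant one. -/
noncomputable def choleskyFactor (p q d : ℝ) (hp : 0 < p) (hd : 0 < d) : SL(2, ℝ) :=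
  ⟨!![√(p / √d), 0; q / √d / √(p / √d), (√(p / √d))⁻¹], by
    rw [det_fin_two_of, zero_mul, sub_zero]
    exact mul_inv_cancel₀ (by positivity)⟩

theorem choleskyFactor_mul_transpose {p q r : ℝ} (hp : 0 < p) (hd : 0 < p * r - q ^ 2) :
    (choleskyFactor p q (p * r - q ^ 2) hp hd : Matrix (Fin 2) (Fin 2) ℝ) *
      (choleskyFactor p q (p * r - q ^ 2) hp hd : Matrix (Fin 2) (Fin 2) ℝ)ᵀ =
      (√(p * r - q ^ 2))⁻¹ • !![p, q; q, r] := by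
  have hs : 0 < √(p * r - q ^ 2) := Real.sqrt_pos.2 hd
  have hs2 := Real.sq_sqrt hd.le
  simp only [choleskyFactor]
  set s := √(p * r - q ^ 2)
  have ht : 0 < √(p / s) := by positivity
  have ht2 : √(p / s) ^ 2 = p / s := Real.sq_sqrt (by positivity)
  set t := √(p / s)
  have hps : p = t ^ 2 * s := by rw [ht2]; field_simp
  ext i j
  fin_cases i <;> fin_cases j <;> simp [mul_apply, Fin.sum_univ_two]
  · rw [← sq, ht2]; field_simp
  · field_simp
  · field_simp
  · have : q ^ 2 + s ^ 2 = t ^ 2 * s * r := by rw [← hps]; linarith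
    field_simp
    linarith

/-- Each diagonal entry of `L * Lᵀ` is the squared length of a row of `L`. -/
theorem choleskyFactor_entry_le {p q r c K : ℝ} (hp : 0 < p) (hd : 0 < p * r - q ^ 2)
    (hc : 0 < c) (hcd : c ^ 2 ≤ p * r - q ^ 2) (hpK : p ≤ K) (hrK : r ≤ K) (i j : Fin 2) :
    |(choleskyFactor p q (p * r - q ^ 2) hp hd : Matrix (Fin 2) (Fin 2) ℝ) i j| ≤ √(K / c) := by
  have hcs : c ≤ √(p * r - q ^ 2) := Real.le_sqrt_of_sq_le hcd
  have h := choleskyFactor_mul_transpose hp hd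
  set s := √(p * r - q ^ 2)
  set L := (choleskyFactor p q (p * r - q ^ 2) hp hd : Matrix (Fin 2) (Fin 2) ℝ)
  have hK : 0 ≤ K := hp.le.trans hpK
  have hdiag : (s⁻¹ • !![p, q; q, r]) i i ≤ K / c := by
    have : ∀ x ≤ K, s⁻¹ * x ≤ K / c := fun x hx => by
      rw [inv_mul_eq_div]
      exact (div_le_div_of_nonneg_right hx (hc.le.trans hcs)).trans
        (div_le_div_of_nonneg_left hK hc hcs)
    fin_cases i
    · simpa using this p hpK
    · simpa using this r hrK
  rw [← h, mul_apply, Fin.sum_univ_two, transpose_apply, transpose_apply] at hdiag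
  refine Real.abs_le_sqrt (le_trans ?_ hdiag)
  fin_cases j <;> simp only [Fin.zero_eta, Fin.mk_one]
  · nlinarith [mul_self_nonneg (L i 1)]
  · nlinarith [mul_self_nonneg (L i 0)]

/-- Transpose, inverse and adjugate coincide, so the first column is a unit vector determining the
matrix; its argument as a complex number is the angle. -/
theorem isRotationMatrix_of_mul_transpose {R : SL(2, ℝ)}
    (h : (R : Matrix (Fin 2) (Fin 2) ℝ) * (R : Matrix (Fin 2) (Fin 2) ℝ)ᵀ = 1) :
    IsRotationMatrix R := by
  have hadj : (R : Matrix (Fin 2) (Fin 2) ℝ)ᵀ = adjugate (R : Matrix (Fin 2) (Fin 2) ℝ) := by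
    have hl : adjugate (R : Matrix (Fin 2) (Fin 2) ℝ) * (R : Matrix (Fin 2) (Fin 2) ℝ) = 1 := by
      rw [adjugate_mul, R.det_coe, one_smul]
    calc _ = adjugate (R : Matrix (Fin 2) (Fin 2) ℝ) * (R : Matrix (Fin 2) (Fin 2) ℝ) *
          (R : Matrix (Fin 2) (Fin 2) ℝ)ᵀ := by rw [hl, one_mul]
      _ = _ := by rw [mul_assoc, h, mul_one]
  rw [adjugate_fin_two] at hadj
  have h00 := congrFun₂ hadj 0 0
  have h01 := congrFun₂ hadj 0 1
  have hdet := R.det_coe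
  rw [det_fin_two] at hdet
  simp only [transpose_apply, of_apply, cons_val', cons_val_zero, cons_val_one,
    cons_val_fin_one] at h00 h01
  set M := (R : Matrix (Fin 2) (Fin 2) ℝ)
  have hsq : M 0 0 ^ 2 + M 1 0 ^ 2 = 1 := by
    rw [← h00] at hdet
    linear_combination hdet + M 1 0 * h01
  set z : ℂ := ⟨M 0 0, M 1 0⟩ with hz
  have hn : ‖z‖ = 1 := by
    rw [Complex.norm_def, Complex.normSq_mk, ← sq, ← sq, hsq, Real.sqrt_one]
  have hz0 : z ≠ 0 := norm_ne_zero_iff.1 (by rw [hn]; exact one_ne_zero)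
  refine ⟨z.arg, ?_⟩
  rw [Complex.cos_arg hz0, Complex.sin_arg, hn, div_one, div_one]
  ext i j
  fin_cases i <;> fin_cases j <;> simp [hz] <;> linarith

theorem isRotationMatrix_inv_mul_mul {A B B' : SL(2, ℝ)}
    (h : (A : Matrix (Fin 2) (Fin 2) ℝ) * ((B : Matrix (Fin 2) (Fin 2) ℝ) *
      (B : Matrix (Fin 2) (Fin 2) ℝ)ᵀ) * (A : Matrix (Fin 2) (Fin 2) ℝ)ᵀ =
      (B' : Matrix (Fin 2) (Fin 2) ℝ) * (B' : Matrix (Fin 2) (Fin 2) ℝ)ᵀ) :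
    IsRotationMatrix (B'⁻¹ * A * B) := by
  apply isRotationMatrix_of_mul_transpose
  have hinv : ((B'⁻¹ : SL(2, ℝ)) : Matrix (Fin 2) (Fin 2) ℝ) *
      (B' : Matrix (Fin 2) (Fin 2) ℝ) = 1 := by
    rw [← Matrix.SpecialLinearGroup.coe_mul, inv_mul_cancel, Matrix.SpecialLinearGroup.coe_one]
  simp only [Matrix.SpecialLinearGroup.coe_mul, transpose_mul]
  generalize ((B'⁻¹ : SL(2, ℝ)) : Matrix (Fin 2) (Fin 2) ℝ) = N at *
  calc _ = N * ((A : Matrix (Fin 2) (Fin 2) ℝ) * ((B : Matrix (Fin 2) (Fin 2) ℝ) *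
        (B : Matrix (Fin 2) (Fin 2) ℝ)ᵀ) * (A : Matrix (Fin 2) (Fin 2) ℝ)ᵀ) * Nᵀ := by
        simp only [mul_assoc]
    _ = (N * (B' : Matrix (Fin 2) (Fin 2) ℝ)) * (N * (B' : Matrix (Fin 2) (Fin 2) ℝ))ᵀ := by
        rw [h, transpose_mul]; simp only [mul_assoc]
    _ = 1 := by rw [hinv, transpose_one, mul_one]

open scoped Matrix.Norms.Elementwise in
theorem IsMeasurableSL.isLinftyBounded {B : UnitAddCircle → SL(2, ℝ)} (hB : IsMeasurableSL B)
    {K : ℝ} (hK : 0 ≤ K) (h : ∀ θ i j, |(B θ : Matrix (Fin 2) (Fin 2) ℝ) i j| ≤ K) :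
    IsLinftyBounded B := by
  refine memLp_top_of_bound (C := K) ?_
    (Filter.Eventually.of_forall fun θ => (Matrix.norm_le_iff hK).2 (h θ))
  have hm : Measurable fun θ i j => (B θ : Matrix (Fin 2) (Fin 2) ℝ) i j :=
    measurable_pi_lambda _ fun i => measurable_pi_lambda _ fun j => hB i j
  exact hm.aestronglyMeasurable

theorem mainTheorem11 (α : UnitAddCircle) (A : UnitAddCircle → SL(2, ℝ)) (hA : Continuous A)
    (hbdd : HasBoundedFiberedProducts α A) :
    ∃ B : UnitAddCircle → SL(2, ℝ), IsMeasurableSL B ∧ IsLinftyBounded B ∧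
      ∀ᵐ θ ∂(volume : Measure UnitAddCircle),
        IsRotationMatrix ((B (θ + α))⁻¹ * A θ * B θ) := by
  obtain ⟨r, hr, hrE⟩ := exists_closedBall_subset_orbitBall hbdd
  have hE := orbitBall_subset_closedBall α A
  set M := fun θ => momentMatrix (orbitBall α A θ)
  have hsymm : ∀ θ, M θ 1 0 = M θ 0 1 := fun θ => momentMatrix_symm _
  set c := momentMatrix (Metric.closedBall 0 r) 0 0
  have hc : 0 < c := momentMatrix_closedBall_pos hr
  have hp : ∀ θ, 0 < M θ 0 0 := fun θ => hc.trans_le (momentMatrix_diag_mono (hrE θ) (hE θ) 0)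
  have hcd : ∀ θ, c ^ 2 ≤ M θ 0 0 * M θ 1 1 - M θ 0 1 ^ 2 :=
    fun θ => sq_le_det_momentMatrix hr (hrE θ) (hE θ)
  have hd : ∀ θ, 0 < M θ 0 0 * M θ 1 1 - M θ 0 1 ^ 2 :=
    fun θ => (pow_pos hc 2).trans_le (hcd θ)
  have hdet : ∀ θ, (M θ).det = M θ 0 0 * M θ 1 1 - M θ 0 1 ^ 2 := fun θ => by
    rw [det_fin_two, hsymm, sq]
  have hequi : ∀ θ, M (θ + α) = (A θ : Matrix (Fin 2) (Fin 2) ℝ) * M θ *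
      (A θ : Matrix (Fin 2) (Fin 2) ℝ)ᵀ := fun θ => by
    have h := momentMatrix_eq_mul_mul_transpose (A θ : Matrix (Fin 2) (Fin 2) ℝ) (by simp)
      (measurableSet_orbitBall α hA (θ + α)) (by rw [preimage_orbitBall]; exact hE θ)
    rwa [preimage_orbitBall] at h
  have hmeas : ∀ i j, Measurable fun θ => M θ i j := measurable_momentMatrix_orbitBall α hA
  let B := fun θ => choleskyFactor (M θ 0 0) (M θ 0 1) _ (hp θ) (hd θ)
  have hBB : ∀ θ, (B θ : Matrix (Fin 2) (Fin 2) ℝ) * (B θ : Matrix (Fin 2) (Fin 2) ℝ)ᵀ =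
      (√(M θ).det)⁻¹ • M θ := fun θ => by
    rw [choleskyFactor_mul_transpose, hdet]
    congr 1
    conv_rhs => rw [eta_fin_two (M θ)]
    rw [hsymm]
  have hBmeas : IsMeasurableSL B := by
    have h00 := hmeas 0 0
    have h01 := hmeas 0 1
    have h11 := hmeas 1 1
    intro i j
    fin_cases i <;> fin_cases j <;> simp only [B, choleskyFactor] <;> simp <;> fun_prop
  refine ⟨B, hBmeas, ?_, Filter.Eventually.of_forall fun θ => ?_⟩
  · set K := max (momentMatrix (Metric.closedBall 0 1) 0 0)
      (momentMatrix (Metric.closedBall 0 1) 1 1)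
    exact hBmeas.isLinftyBounded (Real.sqrt_nonneg (K / c)) fun θ i j =>
      choleskyFactor_entry_le (hp θ) (hd θ) hc (hcd θ)
        ((momentMatrix_diag_mono (hE θ) subset_rfl 0).trans (le_max_left _ _))
        ((momentMatrix_diag_mono (hE θ) subset_rfl 1).trans (le_max_right _ _)) i j
  · apply isRotationMatrix_inv_mul_mul
    -- Equal determinants let the normalizing scalars at `θ` and `θ + α` agree.
    have hdet' : (M (θ + α)).det = (M θ).det := by simp [hequi θ]
    rw [hBB, hBB, hdet', hequi θ, Matrix.mul_smul, Matrix.smul_mul]
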